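/- Let $\mathbb{E}^N$ be Euclidean $N$-space. A smocking of $\mathbb{E}^N$ is a finite or countable collection $\{I_j : j\in J\}$ of pairwise disjoint, nonempty, connected, compact sets (stitches) with positive separation factor $\delta=\inf\{|z-z'| : z\in I_j,\ z'\in I_{j'},\ j\ne j'\}>0$. Let $S=\bigcup_j I_j$. The smocked space is $X=(\mathbb{E}^N\setminus S)\cup\{I_j : j\in J\}$, with smocking map $\pi:\mathbb{E}^N\to X$, $\pi(x)=x$ for $x\notin S$ and $\pi(x)=I_j$ for $x\in I_j$, and metric $$d(p,q)=\inf\Big\{|v-z_1|+\sum_{i=1}^{m-1}|z_i'-z_{i+1}|+|z_m'-w| \ :\ m\ge 0,\ \pi(v)=p,\ \pi(w)=q,\ z_i,z_i'\in I_{j_i},\ j_i\neq j_{i+1}\Big\},$$ where for $m=0$ the sum is read as $|v-w|$. Its smocking constants are the separation factor $\delta$, the depth $h=\inf\{r : \forall x\in\mathbb{E}^N\ \exists j\in J\ \exists z\in I_j,\ |x-z|<r\}$, and the lengths $L_{\min}=\inf_j \operatorname{diam} I_j$, $L_{\max}=\sup_j\operatorname{diam} I_j$. A sequence $(Y_n,y_n)$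 of complete noncompact pointed metric spaces converges in the pointed Gromov–Hausdorff sense to a complete noncompact pointed metric space $(Y,y)$ if for every $R>0$ the Gromov–Hausdorff distance between the closures $\overline{B}_R(y_n)$ and $\overline{B}_R(y)$ of the balls of radius $R$, with the restricted metrics, tends to $0$. **Proposition 3.5.** Let $X_k$, $k\in\mathbb{N}$, be smocked spaces obtained from smockings of the same $\mathbb{E}^N$, with smocking maps $\pi_k$ and smocking constants $L_{\max}^{(k)}$, $L_{\min}^{(k)}$, $h^{(k)}$, $\delta^{(k)}$. Suppose there are constants $L_{\max}<\infty$, $h<\infty$, $\delta>0$ and $L_{\min}>0$, independent of $k$, such that for all $k$ $$L_{\max}^{(k)}\le L_{\max},\qquad h^{(k)}\le h,\qquad \delta^{(k)}\ge\delta,\qquad L_{\min}^{(k)}\ge L_{\min}.$$ Then the family $\{(X_k,\pi_k(0))\}_{k}$ is precompact in the pointed Gromov–Hausdorff topology: every sequence of members of the family has a subsequence which converges in the pointed Gromov–Hausdorff sense to some complete noncompact pointed metric space. -/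

import Mathlib

open Set Filter Topology
open scoped ENNReal NNReal

/-! ### Gromov–Hausdorff distance and pointed Gromov–Hausdorff convergence -/

/-- The Gromov–Hausdorff distance of two metric spaces: the infimum of the Hausdorff distances of
`f(X)` and `g(Y)` over all metric spaces `Z` and isometric embeddings `f : X → Z`, `g : Y → Z`. -/
noncomputable def ghEDist (X Y : Type) [MetricSpace X] [MetricSpace Y] : ℝ≥0∞ :=
  ⨅ (Z : Type) (_ : MetricSpace Z) (f : X → Z) (g : Y → Z) (_ : Isometry f) (_ : Isometry g),
    Metric.hausdorffEDist (range f) (range g)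

/-- Pointed Gromov–Hausdorff convergence of a sequence of complete noncompact pointed metric spaces
to a complete noncompact pointed metric space: for every `R > 0`, the closures of the balls of
radius `R` about the base points converge in the Gromov–Hausdorff distance. -/
structure PGHConverges {X : ℕ → Type} [∀ j, MetricSpace (X j)] (x : ∀ j, X j)
    {Y : Type} [MetricSpace Y] (y : Y) : Prop where
  complete : ∀ j, CompleteSpace (X j)
  noncompact : ∀ j, NoncompactSpace (X j)
  complete_lim : CompleteSpace Y
  noncompact_lim : NoncompactSpace Y
  tendsto_ball : ∀ R : ℝ, 0 < R →
    Tendsto (fun j => ghEDist (closure (Metric.ball (x j) R)) (closure (Metric.ball y R)))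
      atTop (𝓝 0)

/-- A family of pointed metric spaces is precompact in the pointed Gromov–Hausdorff topology if
every sequence of members of the family has a subsequence which converges in the pointed
Gromov–Hausdorff sense (to some pointed metric space, not necessarily in the family). -/
def PGHPrecompact {ι : Type} {X : ι → Type} [∀ i, MetricSpace (X i)] (x : ∀ i, X i) : Prop :=
  ∀ s : ℕ → ι, ∃ φ : ℕ → ℕ, StrictMono φ ∧
    ∃ (Y : Type) (_ : MetricSpace Y) (y : Y), PGHConverges (fun j => x (s (φ j))) y

/-! ### Smocked spaces -/

/-- A collection of smocking stitches in Euclidean space `𝔼^N`: a finite or countable collection of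
disjoint connected compact (nonempty) sets, with a positive separation between distinct ones. -/
structure Smocking (N : ℕ) where
  J : Type
  countable : Countable J
  stitch : J → Set (EuclideanSpace ℝ (Fin N))
  isCompact : ∀ j, IsCompact (stitch j)
  isConnected : ∀ j, IsConnected (stitch j)
  disjoint : ∀ i j, i ≠ j → Disjoint (stitch i) (stitch j)
  separation_pos :
    0 < ⨅ (i : J) (j : J) (_ : i ≠ j) (z ∈ stitch i) (z' ∈ stitch j), edist z z'

namespace Smocking

variable {N : ℕ} (P : Smocking N)

/-- The smocking separation factor `δ` (which is `∞` if there is at most one stitch). -/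
noncomputable def separation : ℝ≥0∞ :=
  ⨅ (i : P.J) (j : P.J) (_ : i ≠ j) (z ∈ P.stitch i) (z' ∈ P.stitch j), edist z z'

/-- The smocking depth `h`: the infimum of all `r` such that every point lies at distance less
than `r` from some stitch (`∞` if there is no finite such `r`). -/
noncomputable def depth : ℝ≥0∞ :=
  sInf {r : ℝ≥0∞ | ∀ x : EuclideanSpace ℝ (Fin N), ∃ j, ∃ z ∈ P.stitch j, edist x z < r}

/-- The minimum smocking length `L_min`, the infimum of the diameters of the stitches. -/
noncomputable def lengthMin : ℝ≥0∞ := ⨅ j, Metric.ediam (P.stitch j)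

/-- The maximum smocking length `L_max`, the supremum of the diameters of the stitches. -/
noncomputable def lengthMax : ℝ≥0∞ := ⨆ j, Metric.ediam (P.stitch j)

/-- The smocking set `S`, the union of the stitches. -/
def smockingSet : Set (EuclideanSpace ℝ (Fin N)) := ⋃ j, P.stitch j

/-- The underlying set of the smocked space: the points outside the smocking set, together with one
point for each stitch. -/
inductive Space : Type
  | point (x : {x : EuclideanSpace ℝ (Fin N) // x ∉ P.smockingSet})
  | collapsed (j : P.J)

open Classical in
/-- The smocking map `π`: the identity off the smocking set, and constant on each stitch. -/
noncomputable def proj (x : EuclideanSpace ℝ (Fin N)) : P.Space :=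
  if h : x ∈ P.smockingSet then .collapsed (mem_iUnion.1 h).choose else .point ⟨x, h⟩

/-- The sum `|v - z₁| + ∑ |z'ᵢ - zᵢ₊₁| + |z'ₖ - w|` for a list of triples `(jᵢ, zᵢ, z'ᵢ)`; it
is `|v - w|` for the empty list. -/
noncomputable def pathLength (v : EuclideanSpace ℝ (Fin N)) :
    List (P.J × EuclideanSpace ℝ (Fin N) × EuclideanSpace ℝ (Fin N)) →
      EuclideanSpace ℝ (Fin N) → ℝ
  | [], w => dist v w
  | a :: l, w => dist v a.2.1 + pathLength a.2.2 l w

/-- The lengths of the chains of segments from `v` to `w` passing through `k` stitches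
`j₁ ≠ j₂ ≠ ⋯ ≠ jₖ`, entering the `i`-th at `zᵢ` and leaving it at `z'ᵢ`. The minimum of
this set (if it is not empty) is `d_k(v, w)`. -/
def chainLengths (k : ℕ) (v w : EuclideanSpace ℝ (Fin N)) : Set ℝ :=
  {ℓ | ∃ l : List (P.J × EuclideanSpace ℝ (Fin N) × EuclideanSpace ℝ (Fin N)),
    l.length = k ∧ (∀ a ∈ l, a.2.1 ∈ P.stitch a.1 ∧ a.2.2 ∈ P.stitch a.1) ∧
    l.IsChain (fun a b => a.1 ≠ b.1) ∧ ℓ = P.pathLength v l w}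

/-- All lengths of chains of segments, through any number of stitches, between points over `p` and
over `q`. -/
def connectingLengths (p q : P.Space) : Set ℝ :=
  {ℓ | ∃ v w, P.proj v = p ∧ P.proj w = q ∧ ∃ k, ℓ ∈ P.chainLengths k v w}

/-- The smocked distance, `min {d_k(v, w) : k ∈ ℕ, π(v) = p, π(w) = q}`. -/
noncomputable def smockedDist (p q : P.Space) : ℝ := sInf (P.connectingLengths p q)

/-! The smocked distance is a metric. -/

theorem proj_of_mem {x : EuclideanSpace ℝ (Fin N)} {j : P.J} (h : x ∈ P.stitch j) :
    P.proj x = Space.collapsed j := by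
  classical
  have hS : x ∈ P.smockingSet := mem_iUnion.2 ⟨j, h⟩
  rw [proj, dif_pos hS]
  congr 1
  by_contra hne
  exact Set.disjoint_left.1 (P.disjoint _ _ hne) (mem_iUnion.1 hS).choose_spec h

theorem proj_of_notMem {x : EuclideanSpace ℝ (Fin N)} (h : x ∉ P.smockingSet) :
    P.proj x = Space.point ⟨x, h⟩ := by
  classical
  rw [proj, dif_neg h]

theorem proj_eq_inl {x : EuclideanSpace ℝ (Fin N)}
    {y : {x : EuclideanSpace ℝ (Fin N) // x ∉ P.smockingSet}}
    (h : P.proj x = Space.point y) : x = y := by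
  by_cases hx : x ∈ P.smockingSet
  · obtain ⟨j, hj⟩ := mem_iUnion.1 hx
    rw [P.proj_of_mem hj] at h
    cases h
  · rw [P.proj_of_notMem hx] at h
    cases h
    rfl

theorem proj_eq_inr {x : EuclideanSpace ℝ (Fin N)} {j : P.J} (h : P.proj x = Space.collapsed j) :
    x ∈ P.stitch j := by
  by_cases hx : x ∈ P.smockingSet
  · obtain ⟨i, hi⟩ := mem_iUnion.1 hx
    rw [P.proj_of_mem hi] at h
    cases h
    exact hi
  · rw [P.proj_of_notMem hx] at h
    cases h

theorem proj_surjective : Function.Surjective P.proj := by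
  rintro (x | j)
  · exact ⟨x, P.proj_of_notMem x.2⟩
  · obtain ⟨z, hz⟩ := (P.isConnected j).nonempty
    exact ⟨z, P.proj_of_mem hz⟩

theorem exists_separation : ∃ δ : ℝ, 0 < δ ∧ ∀ i j, i ≠ j → ∀ z ∈ P.stitch i, ∀ z' ∈ P.stitch j,
    δ ≤ dist z z' := by
  obtain ⟨ε, hε, hlt⟩ := ENNReal.lt_iff_exists_nnreal_btwn.1 P.separation_pos
  refine ⟨ε, by exact_mod_cast hε, fun i j hij z hz z' hz' => ?_⟩
  have h : (ε : ℝ≥0∞) ≤ edist z z' :=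
    hlt.le.trans (iInf_le_of_le i <| iInf_le_of_le j <| iInf_le_of_le hij <| iInf_le_of_le z <|
      iInf_le_of_le hz <| iInf_le_of_le z' <| iInf_le _ hz')
  rw [edist_nndist] at h
  rw [← coe_nndist]
  exact_mod_cast h

theorem isClosed_smockingSet : IsClosed P.smockingSet := by
  obtain ⟨δ, hδ, hsep⟩ := P.exists_separation
  refine LocallyFinite.isClosed_iUnion (fun x => ⟨Metric.ball x (δ / 2),
    Metric.ball_mem_nhds x (half_pos hδ), ?_⟩) (fun j => (P.isCompact j).isClosed)
  refine Set.Subsingleton.finite ?_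
  rintro i ⟨z, hz, hzx⟩ j ⟨z', hz', hzx'⟩
  by_contra hij
  have h1 := hsep i j hij z hz z' hz'
  have h2 := dist_triangle_right z z' x
  rw [Metric.mem_ball] at hzx hzx'
  linarith

theorem pathLength_nonneg (v w : EuclideanSpace ℝ (Fin N))
    (l : List (P.J × EuclideanSpace ℝ (Fin N) × EuclideanSpace ℝ (Fin N))) :
    0 ≤ P.pathLength v l w := by
  induction l generalizing v with
  | nil => exact dist_nonneg
  | cons a l ih => exact add_nonneg dist_nonneg (ih _)

theorem pathLength_append (v w : EuclideanSpace ℝ (Fin N))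
    (l m : List (P.J × EuclideanSpace ℝ (Fin N) × EuclideanSpace ℝ (Fin N)))
    (a : P.J × EuclideanSpace ℝ (Fin N) × EuclideanSpace ℝ (Fin N)) :
    P.pathLength v (l ++ a :: m) w = P.pathLength v l a.2.1 + P.pathLength a.2.2 m w := by
  induction l generalizing v with
  | nil => rfl
  | cons b l ih =>
    simp only [List.cons_append, pathLength]
    rw [ih, add_assoc]

theorem pathLength_triangle (v v' w : EuclideanSpace ℝ (Fin N))
    (l : List (P.J × EuclideanSpace ℝ (Fin N) × EuclideanSpace ℝ (Fin N))) :
    P.pathLength v l w ≤ dist v v' + P.pathLength v' l w := by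
  cases l with
  | nil => exact dist_triangle _ _ _
  | cons a l =>
    simp only [pathLength]
    linarith [dist_triangle v v' a.2.1]

theorem pathLength_append_le (v w u : EuclideanSpace ℝ (Fin N))
    (l m : List (P.J × EuclideanSpace ℝ (Fin N) × EuclideanSpace ℝ (Fin N))) :
    P.pathLength v (l ++ m) u ≤ P.pathLength v l w + P.pathLength w m u := by
  induction l generalizing v with
  | nil => exact P.pathLength_triangle v w u m
  | cons b l ih =>
    simp only [List.cons_append, pathLength]
    linarith [ih b.2.2]

theorem pathLength_reverse (v w : EuclideanSpace ℝ (Fin N))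
    (l : List (P.J × EuclideanSpace ℝ (Fin N) × EuclideanSpace ℝ (Fin N))) :
    P.pathLength w (l.reverse.map fun a => (a.1, a.2.2, a.2.1)) v = P.pathLength v l w := by
  induction l generalizing v with
  | nil => exact dist_comm _ _
  | cons a l ih =>
    simp only [List.reverse_cons, List.map_append, List.map_cons, List.map_nil]
    rw [pathLength_append, ih]
    simp only [pathLength]
    rw [dist_comm, add_comm]

theorem exists_reduced (w : EuclideanSpace ℝ (Fin N))
    (l : List (P.J × EuclideanSpace ℝ (Fin N) × EuclideanSpace ℝ (Fin N)))
    (hl : ∀ a ∈ l, a.2.1 ∈ P.stitch a.1 ∧ a.2.2 ∈ P.stitch a.1) :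
    ∃ m : List (P.J × EuclideanSpace ℝ (Fin N) × EuclideanSpace ℝ (Fin N)),
      (∀ a ∈ m, a.2.1 ∈ P.stitch a.1 ∧ a.2.2 ∈ P.stitch a.1) ∧
      m.IsChain (fun a b => a.1 ≠ b.1) ∧ ∀ v, P.pathLength v m w ≤ P.pathLength v l w := by
  induction l with
  | nil => exact ⟨[], by simp, by simp, fun v => le_rfl⟩
  | cons a l ih =>
    obtain ⟨m, hm, hc, hle⟩ := ih fun b hb => hl b (List.mem_cons_of_mem _ hb)
    have ha := hl a List.mem_cons_self
    cases m with
    | nil =>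
      refine ⟨[a], by simpa using ha, by simp, fun v => ?_⟩
      simpa only [pathLength, add_le_add_iff_left] using hle a.2.2
    | cons b m =>
      by_cases hab : a.1 = b.1
      · refine ⟨(b.1, a.2.1, b.2.2) :: m, ?_, ?_, fun v => ?_⟩
        · intro c hc'
          rcases List.mem_cons.1 hc' with rfl | hc'
          · exact ⟨hab ▸ ha.1, (hm b List.mem_cons_self).2⟩
          · exact hm c (List.mem_cons_of_mem _ hc')
        · cases m with
          | nil => simp
          | cons d m =>
            rw [List.isChain_cons_cons] at hc ⊢
            exact hc
        · have h := hle a.2.2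
          simp only [pathLength] at h ⊢
          linarith [dist_nonneg (x := a.2.2) (y := b.2.1)]
      · refine ⟨a :: b :: m, ?_, List.isChain_cons_cons.2 ⟨hab, hc⟩, fun v => ?_⟩
        · intro c hc'
          rcases List.mem_cons.1 hc' with rfl | hc'
          · exact ha
          · exact hm c hc'
        · have h := hle a.2.2
          simp only [pathLength] at h ⊢
          linarith

theorem connectingLengths_nonneg {p q : P.Space} {ℓ : ℝ} (h : ℓ ∈ P.connectingLengths p q) :
    0 ≤ ℓ := by
  obtain ⟨v, w, -, -, k, l, -, -, -, rfl⟩ := h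
  exact P.pathLength_nonneg v w l

theorem bddBelow_connectingLengths (p q : P.Space) : BddBelow (P.connectingLengths p q) :=
  ⟨0, fun _ h => P.connectingLengths_nonneg h⟩

theorem dist_mem_connectingLengths (v w : EuclideanSpace ℝ (Fin N)) :
    dist v w ∈ P.connectingLengths (P.proj v) (P.proj w) :=
  ⟨v, w, rfl, rfl, 0, [], rfl, by simp, by simp, rfl⟩

theorem connectingLengths_nonempty (p q : P.Space) : (P.connectingLengths p q).Nonempty := by
  obtain ⟨v, rfl⟩ := P.proj_surjective p
  obtain ⟨w, rfl⟩ := P.proj_surjective q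
  exact ⟨_, P.dist_mem_connectingLengths v w⟩

theorem smockedDist_self (p : P.Space) : P.smockedDist p p = 0 := by
  obtain ⟨v, rfl⟩ := P.proj_surjective p
  refine le_antisymm ?_ (Real.sInf_nonneg fun _ h => P.connectingLengths_nonneg h)
  have h := P.dist_mem_connectingLengths v v
  rw [dist_self] at h
  exact csInf_le (P.bddBelow_connectingLengths _ _) h

theorem connectingLengths_symm {p q : P.Space} {ℓ : ℝ} (h : ℓ ∈ P.connectingLengths p q) :
    ℓ ∈ P.connectingLengths q p := by
  obtain ⟨v, w, hv, hw, k, l, hk, hl, hc, rfl⟩ := h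
  refine ⟨w, v, hw, hv, k, l.reverse.map fun a => (a.1, a.2.2, a.2.1), by simpa using hk, ?_, ?_,
    (P.pathLength_reverse v w l).symm⟩
  · intro a ha
    obtain ⟨b, hb, rfl⟩ := List.mem_map.1 ha
    exact (hl b (List.mem_reverse.1 hb)).symm
  · rw [List.isChain_map, List.isChain_reverse]
    exact hc.imp fun a b hab => hab.symm

theorem smockedDist_comm (p q : P.Space) : P.smockedDist p q = P.smockedDist q p := by
  unfold smockedDist
  congr 1
  ext ℓ
  exact ⟨P.connectingLengths_symm, P.connectingLengths_symm⟩

theorem exists_connecting_le_add {p q r : P.Space} {a b : ℝ} (ha : a ∈ P.connectingLengths p q)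
    (hb : b ∈ P.connectingLengths q r) : ∃ c ∈ P.connectingLengths p r, c ≤ a + b := by
  obtain ⟨v, w, hv, hw, -, l, -, hl, -, rfl⟩ := ha
  obtain ⟨w', u, hw', hu, -, m, -, hm, -, rfl⟩ := hb
  suffices h : ∃ n : List (P.J × EuclideanSpace ℝ (Fin N) × EuclideanSpace ℝ (Fin N)),
      (∀ a ∈ n, a.2.1 ∈ P.stitch a.1 ∧ a.2.2 ∈ P.stitch a.1) ∧
      P.pathLength v n u ≤ P.pathLength v l w + P.pathLength w' m u by
    obtain ⟨n, hn, hle⟩ := h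
    obtain ⟨n', hn', hc, hle'⟩ := P.exists_reduced u n hn
    exact ⟨_, ⟨v, u, hv, hu, _, n', rfl, hn', hc, rfl⟩, (hle' v).trans hle⟩
  rcases q with x | j
  · have h1 := P.proj_eq_inl hw
    have h2 := P.proj_eq_inl hw'
    refine ⟨l ++ m, ?_, ?_⟩
    · intro a ha
      rcases List.mem_append.1 ha with ha | ha
      · exact hl a ha
      · exact hm a ha
    · rw [h1, h2]
      exact P.pathLength_append_le v x u l m
  · have h1 := P.proj_eq_inr hw
    have h2 := P.proj_eq_inr hw'
    refine ⟨l ++ (j, w, w') :: m, ?_, (P.pathLength_append v u l m (j, w, w')).le⟩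
    intro a ha
    rcases List.mem_append.1 ha with ha | ha
    · exact hl a ha
    · rcases List.mem_cons.1 ha with rfl | ha
      · exact ⟨h1, h2⟩
      · exact hm a ha

theorem smockedDist_triangle (p q r : P.Space) :
    P.smockedDist p r ≤ P.smockedDist p q + P.smockedDist q r := by
  refine le_of_forall_pos_le_add fun ε hε => ?_
  obtain ⟨a, ha, ha'⟩ := exists_lt_of_csInf_lt (P.connectingLengths_nonempty p q)
    (lt_add_of_pos_right (P.smockedDist p q) (half_pos hε))
  obtain ⟨b, hb, hb'⟩ := exists_lt_of_csInf_lt (P.connectingLengths_nonempty q r)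
    (lt_add_of_pos_right (P.smockedDist q r) (half_pos hε))
  obtain ⟨c, hc, hle⟩ := P.exists_connecting_le_add ha hb
  have := csInf_le (P.bddBelow_connectingLengths p r) hc
  unfold smockedDist at *
  linarith

theorem le_pathLength_of_separation {δ : ℝ} (hδ : ∀ i j, i ≠ j → ∀ z ∈ P.stitch i,
      ∀ z' ∈ P.stitch j, δ ≤ dist z z') {i j : P.J} (hij : i ≠ j)
    {v w : EuclideanSpace ℝ (Fin N)} (hv : v ∈ P.stitch i) (hw : w ∈ P.stitch j)
    (l : List (P.J × EuclideanSpace ℝ (Fin N) × EuclideanSpace ℝ (Fin N)))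
    (hl : ∀ a ∈ l, a.2.1 ∈ P.stitch a.1 ∧ a.2.2 ∈ P.stitch a.1) :
    δ ≤ P.pathLength v l w := by
  induction l generalizing v with
  | nil => exact hδ i j hij v hv w hw
  | cons a l ih =>
    have ha := hl a List.mem_cons_self
    simp only [pathLength]
    by_cases hai : a.1 = i
    · have := ih (hai ▸ ha.2) fun b hb => hl b (List.mem_cons_of_mem _ hb)
      linarith [dist_nonneg (x := v) (y := a.2.1)]
    · have := hδ i a.1 (Ne.symm hai) v hv _ ha.1
      linarith [P.pathLength_nonneg a.2.2 w l]

theorem smockedDist_inl_pos (x : {x : EuclideanSpace ℝ (Fin N) // x ∉ P.smockingSet})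
    {q : P.Space} (hq : Space.point x ≠ q) : 0 < P.smockedDist (Space.point x) q := by
  -- the points over `q` together with the smocking set stay away from `x`
  obtain ⟨ε, hε, hS, hw⟩ : ∃ ε : ℝ, 0 < ε ∧ (∀ z ∈ P.smockingSet, ε ≤ dist x.1 z) ∧
      ∀ w, P.proj w = q → ε ≤ dist (x : EuclideanSpace ℝ (Fin N)) w := by
    obtain ⟨ε, hε, hball⟩ := Metric.isOpen_iff.1 P.isClosed_smockingSet.isOpen_compl x.1 x.2
    have hS : ∀ z ∈ P.smockingSet, ε ≤ dist x.1 z := fun z hz => by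
      by_contra! hlt
      exact hball (by rwa [Metric.mem_ball, dist_comm]) hz
    rcases q with y | j
    · have hxy : x.1 ≠ y.1 := fun h => hq (by rw [Subtype.ext h])
      refine ⟨min ε (dist x.1 y.1), lt_min hε (dist_pos.2 hxy),
        fun z hz => (min_le_left _ _).trans (hS z hz), fun w hw => ?_⟩
      rw [P.proj_eq_inl hw]
      exact min_le_right _ _
    · exact ⟨ε, hε, hS, fun w hw => hS w (mem_iUnion.2 ⟨j, P.proj_eq_inr hw⟩)⟩
  refine hε.trans_le (le_csInf (P.connectingLengths_nonempty _ _) ?_)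
  rintro ℓ ⟨v, w, hv, hwq, -, l, -, hl, -, rfl⟩
  rw [P.proj_eq_inl hv]
  cases l with
  | nil => exact hw w hwq
  | cons a l =>
    simp only [pathLength]
    have := hS a.2.1 (mem_iUnion.2 ⟨a.1, (hl a List.mem_cons_self).1⟩)
    linarith [P.pathLength_nonneg a.2.2 w l]

theorem eq_of_smockedDist_eq_zero {p q : P.Space} (h : P.smockedDist p q = 0) : p = q := by
  by_contra hpq
  rcases p with x | i
  · exact (P.smockedDist_inl_pos x hpq).ne' h
  · rcases q with y | j
    · rw [smockedDist_comm] at h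
      exact (P.smockedDist_inl_pos y (Ne.symm hpq)).ne' h
    · have hij : i ≠ j := fun e => hpq (by rw [e])
      obtain ⟨δ, hδ, hsep⟩ := P.exists_separation
      have : δ ≤ P.smockedDist (Space.collapsed i) (Space.collapsed j) := by
        refine le_csInf (P.connectingLengths_nonempty _ _) ?_
        rintro ℓ ⟨v, w, hv, hw, -, l, -, hl, -, rfl⟩
        exact P.le_pathLength_of_separation hsep hij (P.proj_eq_inr hv) (P.proj_eq_inr hw) l hl
      linarith

/-- The smocked space as a metric space, with the smocked distance. -/
noncomputable instance instMetricSpaceSpace : MetricSpace P.Space where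
  dist := P.smockedDist
  dist_self := P.smockedDist_self
  dist_comm := P.smockedDist_comm
  dist_triangle := P.smockedDist_triangle
  eq_of_dist_eq_zero := P.eq_of_smockedDist_eq_zero

end Smocking

/-! All the `X_k` are quotients of one proper space `E = 𝔼^N`, so each smocked metric can be pulled
back to a pseudo-distance `d_k` on `E`. Since `d_k(v, w) ≤ |v - w|`, these functions are
equi-Lipschitz and pointwise bounded on `E × E`, and an Arzelà–Ascoli argument extracts a
subsequence converging locally uniformly to a pseudo-distance. Its metric quotient `Y` is the limit.

Two uniform facts turn this into convergence of balls. A chain through `n` stitches has length at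
least `(n - 1)δ` and skips at most `n * L_max`, so `|v - w| ≤ C d_k(v, w) + D`
(`dist_le_mul_dist_proj_add`); hence `R`-balls are covered by images of one fixed Euclidean ball,
and properness and noncompactness descend to the quotients. Cutting a chain gives approximate
intermediate points (`exists_between_of_pathLength_lt`), so a point slightly outside an `R`-ball can
be moved back inside at small cost. Both facts survive the limit (`of_tendsto`) and give
`ghEDist_closure_ball_le`. Depth and `L_min` serve to exclude `N = 0`, where the spaces would be
compact. -/

/-! ### Bounding the Gromov–Hausdorff distance by a correspondence -/

/-- Surjections from a common set whose induced distances differ by at most `2 * ε` bound the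
Gromov–Hausdorff distance by `ε`. -/
theorem ghEDist_le_of_correspondence {X Y Z : Type} [MetricSpace X] [MetricSpace Y] [Nonempty Z]
    {Φ : Z → X} {Ψ : Z → Y} (hΦ : Function.Surjective Φ) (hΨ : Function.Surjective Ψ) {ε : ℝ}
    (ε0 : 0 < ε) (H : ∀ p q, |dist (Φ p) (Φ q) - dist (Ψ p) (Ψ q)| ≤ 2 * ε) :
    ghEDist X Y ≤ ENNReal.ofReal ε := by
  -- The glued metric puts `Φ p` and `Ψ p` at distance exactly `ε`; the distortion bound `2 * ε` is
  -- what its triangle inequality needs.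
  let m : MetricSpace (X ⊕ Y) := Metric.glueMetricApprox Φ Ψ ε ε0 H
  have hd : ∀ p, edist (Sum.inl (Φ p) : X ⊕ Y) (Sum.inr (Ψ p)) ≤ ENNReal.ofReal ε := fun p => by
    rw [edist_dist]
    exact ENNReal.ofReal_le_ofReal (Metric.glueDist_glued_points Φ Ψ ε p).le
  refine iInf_le_of_le (X ⊕ Y) <| iInf_le_of_le m <| iInf_le_of_le Sum.inl <|
    iInf_le_of_le Sum.inr <| iInf_le_of_le (Isometry.of_dist_eq fun _ _ => rfl) <|
    iInf_le_of_le (Isometry.of_dist_eq fun _ _ => rfl) ?_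
  refine Metric.hausdorffEDist_le_of_mem_edist ?_ ?_
  · rintro _ ⟨x, rfl⟩
    obtain ⟨p, rfl⟩ := hΦ x
    exact ⟨_, mem_range_self _, hd p⟩
  · rintro _ ⟨y, rfl⟩
    obtain ⟨p, rfl⟩ := hΨ y
    exact ⟨_, mem_range_self _, by rw [edist_comm]; exact hd p⟩

/-! ### Equi-Lipschitz sequences of functions -/

/-- A pointwise bounded equi-Lipschitz sequence of functions on a separable space has a pointwise
convergent subsequence. -/
theorem exists_subseq_tendsto_of_lipschitzWith {F : Type} [PseudoMetricSpace F]
    [TopologicalSpace.SeparableSpace F] {K : ℝ≥0} {f : ℕ → F → ℝ}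
    (hf : ∀ k, LipschitzWith K (f k)) {b : F → ℝ} (hb : ∀ k x, |f k x| ≤ b x) :
    ∃ φ : ℕ → ℕ, StrictMono φ ∧ ∃ g : F → ℝ, ∀ x, Tendsto (fun k => f (φ k) x) atTop (𝓝 (g x)) := by
  cases isEmpty_or_nonempty F
  · exact ⟨id, strictMono_id, fun _ => 0, fun x => isEmptyElim x⟩
  let u := TopologicalSpace.denseSeq F
  have hu : DenseRange u := TopologicalSpace.denseRange_denseSeq F
  -- A countable product of compact intervals is sequentially compact, which replaces the diagonal
  -- argument over the dense sequence.
  have hc : IsCompact (Set.pi univ fun n => Icc (-b (u n)) (b (u n))) :=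
    isCompact_univ_pi fun n => isCompact_Icc
  obtain ⟨a, -, φ, hφ, ha⟩ := hc.tendsto_subseq (x := fun k n => f k (u n))
    fun k n _ => abs_le.1 (hb k (u n))
  rw [tendsto_pi_nhds] at ha
  have hcau : ∀ x, CauchySeq fun k => f (φ k) x := fun x => by
    rw [Metric.cauchySeq_iff]
    intro ε hε
    -- `K + 1` in place of `K` keeps the radius meaningful when `K = 0`.
    obtain ⟨n, hn⟩ := hu.exists_dist_lt x (show 0 < ε / (3 * (K + 1)) by positivity)
    have hK : K * dist x (u n) ≤ ε / 3 := by
      have : (K + 1 : ℝ) * (ε / (3 * (K + 1))) = ε / 3 := by field_simp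
      nlinarith [dist_nonneg (x := x) (y := u n), K.2]
    obtain ⟨M, hM⟩ := Metric.cauchySeq_iff.1 (ha n).cauchySeq (ε / 3) (by positivity)
    refine ⟨M, fun i hi j hj => ?_⟩
    have h1 := (hf (φ i)).dist_le_mul x (u n)
    have h2 := (hf (φ j)).dist_le_mul x (u n)
    have h3 := hM i hi j hj
    have h4 := dist_triangle4_right (f (φ i) x) (f (φ j) x) (f (φ i) (u n)) (f (φ j) (u n))
    simp only [Function.comp] at h3
    linarith
  choose g hg using fun x => cauchySeq_tendsto_of_complete (hcau x)
  exact ⟨φ, hφ, g, hg⟩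

/-- Pointwise convergence of an equi-Lipschitz sequence is uniform on totally bounded sets. -/
theorem eventually_forall_abs_sub_le_of_lipschitzWith {F : Type} [PseudoMetricSpace F]
    {K : ℝ≥0} {f : ℕ → F → ℝ} {g : F → ℝ} (hf : ∀ k, LipschitzWith K (f k))
    (hg : ∀ x, Tendsto (fun k => f k x) atTop (𝓝 (g x))) {S : Set F} (hS : TotallyBounded S)
    {ε : ℝ} (hε : 0 < ε) : ∀ᶠ k in atTop, ∀ x ∈ S, |f k x - g x| ≤ ε := by
  have hgL : ∀ x y, dist (g x) (g y) ≤ K * dist x y := fun x y =>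
    le_of_tendsto ((hg x).dist (hg y)) (Eventually.of_forall fun k => (hf k).dist_le_mul x y)
  obtain ⟨t, ht, hcov⟩ := Metric.totallyBounded_iff.1 hS (ε / (3 * (K + 1))) (by positivity)
  have hev : ∀ᶠ k in atTop, ∀ y ∈ t, dist (f k y) (g y) < ε / 3 :=
    (eventually_all_finite ht).2 fun y _ => Metric.tendsto_nhds.1 (hg y) _ (by positivity)
  filter_upwards [hev] with k hk x hx
  obtain ⟨y, hy, hxy⟩ := mem_iUnion₂.1 (hcov hx)
  rw [Metric.mem_ball] at hxy
  have hK : K * dist x y ≤ ε / 3 := by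
    have : (K + 1 : ℝ) * (ε / (3 * (K + 1))) = ε / 3 := by field_simp
    nlinarith [dist_nonneg (x := x) (y := y), K.2]
  rw [← Real.dist_eq]
  have h1 := (hf k).dist_le_mul x y
  have h2 := hgL x y
  have h3 := hk y hy
  have h4 := dist_triangle4_right (f k x) (g x) (f k y) (g y)
  linarith

/-- Every pseudo-distance is induced by a surjection to a metric space. -/
theorem exists_metricSpace_quotient {E : Type} (ρ : E → E → ℝ) (h0 : ∀ x, ρ x x = 0)
    (hs : ∀ x y, ρ x y = ρ y x) (ht : ∀ x y z, ρ x z ≤ ρ x y + ρ y z) :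
    ∃ (Y : Type) (_ : MetricSpace Y) (π : E → Y), Function.Surjective π ∧
      ∀ x y, dist (π x) (π y) = ρ x y := by
  let _ : PseudoMetricSpace E := { dist := ρ, dist_self := h0, dist_comm := hs, dist_triangle := ht }
  exact ⟨SeparationQuotient E, inferInstance, SeparationQuotient.mk,
    SeparationQuotient.surjective_mk, fun _ _ => rfl⟩

/-! ### Coarse quotient maps -/

/-- A `1`-Lipschitz surjection onto a space with approximate intermediate points, which is
coarsely expanding with constants `C` and `D`. -/
structure IsCoarseQuotientMap {E X : Type} [MetricSpace E] [MetricSpace X] (C D : ℝ)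
    (π : E → X) : Prop where
  surjective : Function.Surjective π
  dist_map_le : ∀ v w, dist (π v) (π w) ≤ dist v w
  dist_le : ∀ v w, dist v w ≤ C * dist (π v) (π w) + D
  exists_between : ∀ p q : X, ∀ r s : ℝ, 0 < r → 0 < s → dist p q < r + s →
    ∃ u, dist p u < r ∧ dist u q < s

namespace IsCoarseQuotientMap

variable {E X Y : Type} [MetricSpace E] [MetricSpace X] [MetricSpace Y] {C D : ℝ}
  {π : E → X} {ρ : E → Y}

theorem lipschitzWith (h : IsCoarseQuotientMap C D π) : LipschitzWith 1 π :=
  LipschitzWith.of_dist_le_mul fun v w => by simpa using h.dist_map_le v w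

/-- The constant is `2` because `E × E` carries the sup metric. -/
theorem lipschitzWith_dist (h : IsCoarseQuotientMap C D π) :
    LipschitzWith 2 fun p : E × E => dist (π p.1) (π p.2) := by
  have h1 : LipschitzWith 1 fun p : E × E => (π p.1, π p.2) := by
    simpa using (h.lipschitzWith.comp LipschitzWith.prod_fst).prodMk
      (h.lipschitzWith.comp LipschitzWith.prod_snd)
  simpa [Function.comp_def, Function.uncurry] using LipschitzWith.dist.comp h1

/-- By coarse expansion, a closed `r`-ball is a closed subset of the continuous image of a compact
ball of radius `C * r + D`. -/
theorem properSpace [ProperSpace E] (h : IsCoarseQuotientMap C D π) (hC : 0 ≤ C) :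
    ProperSpace X := by
  refine ⟨fun p r => ?_⟩
  obtain ⟨v, rfl⟩ := h.surjective p
  refine ((isCompact_closedBall v (C * r + D)).image h.lipschitzWith.continuous).of_isClosed_subset
    Metric.isClosed_closedBall fun q hq => ?_
  obtain ⟨w, rfl⟩ := h.surjective q
  have h1 := h.dist_le w v
  rw [Metric.mem_closedBall] at hq
  exact ⟨w, Metric.mem_closedBall.2 (by nlinarith), rfl⟩

theorem noncompactSpace [ProperSpace E] [NoncompactSpace E] (h : IsCoarseQuotientMap C D π)
    (hC : 0 ≤ C) : NoncompactSpace X := by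
  rw [← not_compactSpace_iff]
  intro hX
  have hb : Bornology.IsBounded (univ : Set E) := by
    refine Metric.isBounded_iff.2 ⟨C * Metric.diam (univ : Set X) + D, fun v _ w _ => ?_⟩
    have h1 := h.dist_le v w
    have h2 := Metric.dist_le_diam_of_mem (isCompact_univ (X := X)).isBounded
      (mem_univ (π v)) (mem_univ (π w))
    nlinarith
  exact noncompact_univ E (Metric.isCompact_of_isClosed_isBounded isClosed_univ hb)

/-- If `v` lies over `a`, then `ρ v` may fall outside the `R`-ball, but by at most `η`; an
intermediate point between `ρ o` and `ρ v` is inside the ball and within `2 * η` of `ρ v`. -/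
theorem exists_close (hπ : IsCoarseQuotientMap C D π) (hρ : IsCoarseQuotientMap C D ρ)
    (hC : 0 ≤ C) {o : E} {R η : ℝ} (hR : 0 < R) (hη : 0 < η)
    (H : ∀ v ∈ Metric.closedBall o (C * R + D), ∀ w ∈ Metric.closedBall o (C * R + D),
      |dist (π v) (π w) - dist (ρ v) (ρ w)| ≤ η) {a : X}
    (ha : a ∈ closure (Metric.ball (π o) R)) :
    ∃ b ∈ closure (Metric.ball (ρ o) R), ∃ v ∈ Metric.closedBall o (C * R + D),
      dist a (π v) ≤ 2 * η ∧ dist b (ρ v) ≤ 2 * η := by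
  obtain ⟨v, rfl⟩ := hπ.surjective a
  have hv : dist (π v) (π o) ≤ R := Metric.closure_ball_subset_closedBall ha
  have hvo : v ∈ Metric.closedBall o (C * R + D) :=
    Metric.mem_closedBall.2 (by have := hπ.dist_le v o; nlinarith)
  have ho : o ∈ Metric.closedBall o (C * R + D) :=
    Metric.mem_closedBall_self ((dist_nonneg (x := v) (y := o)).trans hvo)
  have h1 := abs_le.1 (H v hvo o ho)
  obtain ⟨b, hb, hbv⟩ := hρ.exists_between (ρ o) (ρ v) R (2 * η) hR (by positivity)
    (by rw [dist_comm]; linarith)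
  exact ⟨b, subset_closure (by rwa [Metric.mem_ball, dist_comm]), v, hvo, by simp [hη.le], hbv.le⟩

theorem ghEDist_closure_ball_le (hπ : IsCoarseQuotientMap C D π) (hρ : IsCoarseQuotientMap C D ρ)
    (hC : 0 ≤ C) {o : E} {R η : ℝ} (hR : 0 < R) (hη : 0 < η)
    (H : ∀ v ∈ Metric.closedBall o (C * R + D), ∀ w ∈ Metric.closedBall o (C * R + D),
      |dist (π v) (π w) - dist (ρ v) (ρ w)| ≤ η) :
    ghEDist (closure (Metric.ball (π o) R)) (closure (Metric.ball (ρ o) R)) ≤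
      ENNReal.ofReal (9 / 2 * η) := by
  -- The correspondence pairs `a` with `b` when both are `2 * η`-close to the images of a common
  -- `v`. Its distortion is at most `4η + η + 4η = 2 * (9 / 2 * η)`.
  let Z := {p : closure (Metric.ball (π o) R) × closure (Metric.ball (ρ o) R) //
    ∃ v ∈ Metric.closedBall o (C * R + D), dist p.1.1 (π v) ≤ 2 * η ∧ dist p.2.1 (ρ v) ≤ 2 * η}
  have hΦ : Function.Surjective fun z : Z => z.1.1 := fun a => by
    obtain ⟨b, hb, v, hv, h1, h2⟩ := hπ.exists_close hρ hC hR hη H a.2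
    exact ⟨⟨(a, ⟨b, hb⟩), v, hv, h1, h2⟩, rfl⟩
  have hΨ : Function.Surjective fun z : Z => z.1.2 := fun b => by
    obtain ⟨a, ha, v, hv, h1, h2⟩ := hρ.exists_close hπ hC hR hη
      (fun v hv w hw => by rw [abs_sub_comm]; exact H v hv w hw) b.2
    exact ⟨⟨(⟨a, ha⟩, b), v, hv, h2, h1⟩, rfl⟩
  obtain ⟨z, -⟩ := hΦ ⟨π o, subset_closure (Metric.mem_ball_self hR)⟩
  have : Nonempty Z := ⟨z⟩
  refine ghEDist_le_of_correspondence hΦ hΨ (by positivity) ?_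
  rintro ⟨⟨a, b⟩, v, hv, hav, hbv⟩ ⟨⟨a', b'⟩, w, hw, haw, hbw⟩
  have h1 := abs_le.1 (H v hv w hw)
  simp only [Subtype.dist_eq] at *
  have h2 := abs_le.1 (dist_dist_dist_le a.1 a'.1 (π v) (π w))
  have h3 := abs_le.1 (dist_dist_dist_le b.1 b'.1 (ρ v) (ρ w))
  exact abs_le.2 ⟨by linarith, by linarith⟩

theorem eventually_abs_sub_le [ProperSpace E] {X : ℕ → Type} [∀ k, MetricSpace (X k)]
    {π : ∀ k, E → X k} (hπ : ∀ k, IsCoarseQuotientMap C D (π k))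
    (hlim : ∀ v w, Tendsto (fun k => dist (π k v) (π k w)) atTop (𝓝 (dist (ρ v) (ρ w))))
    (o : E) (r : ℝ) {η : ℝ} (hη : 0 < η) :
    ∀ᶠ k in atTop, ∀ v ∈ Metric.closedBall o r, ∀ w ∈ Metric.closedBall o r,
      |dist (π k v) (π k w) - dist (ρ v) (ρ w)| ≤ η := by
  have h := eventually_forall_abs_sub_le_of_lipschitzWith (fun k => (hπ k).lipschitzWith_dist)
    (g := fun p : E × E => dist (ρ p.1) (ρ p.2)) (fun p => hlim p.1 p.2)
    ((isCompact_closedBall o r).prod (isCompact_closedBall o r)).totallyBounded hη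
  filter_upwards [h] with k hk v hv w hw
  exact hk (v, w) ⟨hv, hw⟩

/-- The inequalities pass to the limit directly. Intermediate points need not converge, so one is
taken for a single large `k` and transferred to `Y`, with the radii shrunk by `η` beforehand. -/
theorem of_tendsto [ProperSpace E] {X : ℕ → Type} [∀ k, MetricSpace (X k)]
    {π : ∀ k, E → X k} (hπ : ∀ k, IsCoarseQuotientMap C D (π k)) (hC : 0 ≤ C)
    (hρ : Function.Surjective ρ)
    (hlim : ∀ v w, Tendsto (fun k => dist (π k v) (π k w)) atTop (𝓝 (dist (ρ v) (ρ w)))) :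
    IsCoarseQuotientMap C D ρ where
  surjective := hρ
  dist_map_le v w := le_of_tendsto (hlim v w) (Eventually.of_forall fun k => (hπ k).dist_map_le v w)
  dist_le v w := ge_of_tendsto (((hlim v w).const_mul C).add_const D)
    (Eventually.of_forall fun k => (hπ k).dist_le v w)
  exists_between p q r s hr hs hpq := by
    obtain ⟨v, rfl⟩ := hρ p
    obtain ⟨w, rfl⟩ := hρ q
    -- One `η` pays for replacing the limit distance by that of `X k`, the other two for shrinking
    -- `r` and `s`.
    obtain ⟨η, hη, hηr, hηs, hηd⟩ : ∃ η : ℝ, 0 < η ∧ η < r ∧ η < s ∧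
        dist (ρ v) (ρ w) + 3 * η < r + s := by
      have h3 : 0 < (r + s - dist (ρ v) (ρ w)) / 4 := by linarith
      refine ⟨min (min (r / 2) (s / 2)) ((r + s - dist (ρ v) (ρ w)) / 4), by positivity, ?_, ?_, ?_⟩
      all_goals
        have h1 := min_le_left (min (r / 2) (s / 2)) ((r + s - dist (ρ v) (ρ w)) / 4)
        have h2 := min_le_right (min (r / 2) (s / 2)) ((r + s - dist (ρ v) (ρ w)) / 4)
        have h4 := min_le_left (r / 2) (s / 2)
        have h5 := min_le_right (r / 2) (s / 2)
        linarith
    -- A ball about `v` that contains `w` and every point whose image in some `X k` is within `r` of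
    -- that of `v`.
    set t := max (dist w v) (C * r + D)
    obtain ⟨k, hk⟩ := (eventually_abs_sub_le hπ hlim v t hη).exists
    have hw : w ∈ Metric.closedBall v t := Metric.mem_closedBall.2 (le_max_left _ _)
    have hv : v ∈ Metric.closedBall v t :=
      Metric.mem_closedBall_self (dist_nonneg.trans (le_max_left _ _))
    have h1 := abs_le.1 (hk v hv w hw)
    obtain ⟨u, hu1, hu2⟩ := (hπ k).exists_between (π k v) (π k w) (r - η) (s - η)
      (by linarith) (by linarith) (by linarith)
    obtain ⟨x, rfl⟩ := (hπ k).surjective u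
    have hx : x ∈ Metric.closedBall v t := by
      refine Metric.mem_closedBall.2 (le_trans ?_ (le_max_right _ _))
      have := (hπ k).dist_le v x
      rw [dist_comm]
      nlinarith
    have h2 := abs_le.1 (hk v hv x hx)
    have h3 := abs_le.1 (hk x hx w hw)
    exact ⟨ρ x, by linarith, by linarith⟩

/-- Metric spaces which are coarse quotients, with uniform constants, of a fixed proper noncompact
space form a precompact family in the pointed Gromov–Hausdorff topology. -/
theorem pghPrecompact [ProperSpace E] [NoncompactSpace E] {ι : Type} {X : ι → Type}
    [∀ i, MetricSpace (X i)] {π : ∀ i, E → X i} (hπ : ∀ i, IsCoarseQuotientMap C D (π i))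
    (hC : 0 ≤ C) (o : E) : PGHPrecompact fun i => π i o := by
  intro s
  obtain ⟨φ, hφ, g, hg⟩ := exists_subseq_tendsto_of_lipschitzWith
    (fun k => (hπ (s k)).lipschitzWith_dist) (b := fun p => dist p.1 p.2) fun k p => by
      rw [abs_of_nonneg dist_nonneg]
      exact (hπ (s k)).dist_map_le _ _
  -- The limit `g` may vanish at distinct points, so the limit space is its metric quotient.
  obtain ⟨Y, mY, ρ, hρ, hdist⟩ := exists_metricSpace_quotient (fun v w => g (v, w))
    (fun v => tendsto_nhds_unique (hg (v, v)) (by simp))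
    (fun v w => tendsto_nhds_unique (hg (v, w)) (by simpa only [dist_comm] using hg (w, v)))
    (fun u v w => le_of_tendsto_of_tendsto' (hg (u, w)) ((hg (u, v)).add (hg (v, w)))
      fun k => dist_triangle _ _ _)
  have hlim : ∀ v w, Tendsto (fun k => dist (π (s (φ k)) v) (π (s (φ k)) w)) atTop
      (𝓝 (dist (ρ v) (ρ w))) := fun v w => by
    rw [hdist]
    exact hg (v, w)
  have hρ' : IsCoarseQuotientMap C D ρ := of_tendsto (fun k => hπ (s (φ k))) hC hρ hlim
  refine ⟨φ, hφ, Y, mY, ρ o, fun j => ?_, fun j => (hπ _).noncompactSpace hC, ?_,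
    hρ'.noncompactSpace hC, fun R hR => ?_⟩
  · have := (hπ (s (φ j))).properSpace hC
    infer_instance
  · have := hρ'.properSpace hC
    infer_instance
  rw [ENNReal.tendsto_nhds_zero]
  intro ε hε
  obtain ⟨η, hη, hηε⟩ : ∃ η : ℝ, 0 < η ∧ ENNReal.ofReal (9 / 2 * η) ≤ ε := by
    obtain ⟨x, hx, hxε⟩ := ENNReal.lt_iff_exists_nnreal_btwn.1 hε
    have hx : (0 : ℝ) < x := by exact_mod_cast hx
    refine ⟨2 / 9 * x, by positivity, le_trans ?_ hxε.le⟩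
    rw [show (9 / 2 * (2 / 9 * x) : ℝ) = x by ring, ENNReal.ofReal_coe_nnreal]
  filter_upwards [eventually_abs_sub_le (fun k => hπ (s (φ k))) hlim o (C * R + D) hη] with k hk
  exact ((hπ _).ghEDist_closure_ball_le hρ' hC hR hη hk).trans hηε

end IsCoarseQuotientMap

/-! ### Smocking maps are coarse quotient maps with uniform constants. -/

namespace Smocking

variable {N : ℕ} (P : Smocking N)

theorem le_dist_of_le_separation {δ : ℝ≥0} (h : (δ : ℝ≥0∞) ≤ P.separation) {i j : P.J}
    (hij : i ≠ j) {z z' : EuclideanSpace ℝ (Fin N)} (hz : z ∈ P.stitch i) (hz' : z' ∈ P.stitch j) :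
    (δ : ℝ) ≤ dist z z' := by
  have h : (δ : ℝ≥0∞) ≤ edist z z' :=
    h.trans (iInf_le_of_le i <| iInf_le_of_le j <| iInf_le_of_le hij <| iInf_le_of_le z <|
      iInf_le_of_le hz <| iInf_le_of_le z' <| iInf_le _ hz')
  rw [edist_nndist] at h
  rw [← coe_nndist]
  exact_mod_cast h

theorem dist_le_of_lengthMax_le {L : ℝ≥0} (h : P.lengthMax ≤ (L : ℝ≥0∞)) {j : P.J}
    {z z' : EuclideanSpace ℝ (Fin N)} (hz : z ∈ P.stitch j) (hz' : z' ∈ P.stitch j) :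
    dist z z' ≤ L := by
  have h : edist z z' ≤ (L : ℝ≥0∞) :=
    (Metric.edist_le_ediam_of_mem hz hz').trans
      ((le_iSup (fun j => Metric.ediam (P.stitch j)) j).trans h)
  rw [edist_nndist] at h
  rw [← coe_nndist]
  exact_mod_cast h

theorem dist_le_of_proj_eq {L : ℝ≥0} (h : P.lengthMax ≤ (L : ℝ≥0∞))
    {v w : EuclideanSpace ℝ (Fin N)} (hvw : P.proj v = P.proj w) : dist v w ≤ L := by
  cases hw : P.proj w with
  | point x =>
    rw [P.proj_eq_inl (hvw.trans hw), P.proj_eq_inl hw, dist_self]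
    exact L.2
  | collapsed j => exact P.dist_le_of_lengthMax_le h (P.proj_eq_inr (hvw.trans hw)) (P.proj_eq_inr hw)

theorem dist_le_pathLength_add {L : ℝ≥0} (h : P.lengthMax ≤ (L : ℝ≥0∞))
    (v w : EuclideanSpace ℝ (Fin N))
    (l : List (P.J × EuclideanSpace ℝ (Fin N) × EuclideanSpace ℝ (Fin N)))
    (hl : ∀ a ∈ l, a.2.1 ∈ P.stitch a.1 ∧ a.2.2 ∈ P.stitch a.1) :
    dist v w ≤ P.pathLength v l w + l.length * L := by
  induction l generalizing v with
  | nil => simp [pathLength]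
  | cons a l ih =>
    have ha := hl a List.mem_cons_self
    have h1 := ih a.2.2 fun b hb => hl b (List.mem_cons_of_mem _ hb)
    have h2 := P.dist_le_of_lengthMax_le h ha.1 ha.2
    have h3 := dist_triangle4 v a.2.1 a.2.2 w
    simp only [pathLength, List.length_cons]
    push_cast
    linarith

/-- Consecutive stitches are distinct, so each of the `l.length - 1` inner segments costs at least
`δ`; the added `δ` makes up for the missing one. -/
theorem length_mul_le_pathLength_add {δ : ℝ≥0} (h : (δ : ℝ≥0∞) ≤ P.separation)
    (v w : EuclideanSpace ℝ (Fin N))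
    (l : List (P.J × EuclideanSpace ℝ (Fin N) × EuclideanSpace ℝ (Fin N)))
    (hl : ∀ a ∈ l, a.2.1 ∈ P.stitch a.1 ∧ a.2.2 ∈ P.stitch a.1)
    (hc : l.IsChain (fun a b => a.1 ≠ b.1)) :
    l.length * (δ : ℝ) ≤ P.pathLength v l w + δ := by
  induction l generalizing v with
  | nil =>
    have := P.pathLength_nonneg v w []
    simp only [List.length_nil, Nat.cast_zero, zero_mul]
    positivity
  | cons a l ih =>
    cases l with
    | nil => simpa using P.pathLength_nonneg v w [a]
    | cons b l =>
      rw [List.isChain_cons_cons] at hc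
      have ha := hl a List.mem_cons_self
      have hb := hl b (by simp)
      -- starting the tail at the entry point of `b` saves the step from `a` to `b`
      have h1 := ih b.2.1 (fun c hc' => hl c (List.mem_cons_of_mem _ hc')) hc.2
      have h2 := P.le_dist_of_le_separation h hc.1 ha.2 hb.1
      simp only [pathLength, List.length_cons, dist_self] at h1 ⊢
      push_cast at h1 ⊢
      linarith [dist_nonneg (x := v) (y := a.2.1)]

theorem dist_proj_le (v w : EuclideanSpace ℝ (Fin N)) :
    dist (P.proj v) (P.proj w) ≤ dist v w :=
  csInf_le (P.bddBelow_connectingLengths _ _) (P.dist_mem_connectingLengths v w)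

/-- Merging consecutive visits to the same stitch never lengthens a path, so the condition `jᵢ ≠
jᵢ₊₁` can be dropped. -/
theorem dist_proj_le_pathLength (v w : EuclideanSpace ℝ (Fin N))
    (l : List (P.J × EuclideanSpace ℝ (Fin N) × EuclideanSpace ℝ (Fin N)))
    (hl : ∀ a ∈ l, a.2.1 ∈ P.stitch a.1 ∧ a.2.2 ∈ P.stitch a.1) :
    dist (P.proj v) (P.proj w) ≤ P.pathLength v l w := by
  obtain ⟨m, hm, hc, hle⟩ := P.exists_reduced w l hl
  exact (csInf_le (P.bddBelow_connectingLengths _ _) ⟨v, w, rfl, rfl, _, m, rfl, hm, hc, rfl⟩).trans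
    (hle v)

/-- Walk along the chain until the budget `r` is spent: only the segments cost anything, since the
two ends of a stitch have the same image. -/
theorem exists_between_of_pathLength_lt (v w : EuclideanSpace ℝ (Fin N))
    (l : List (P.J × EuclideanSpace ℝ (Fin N) × EuclideanSpace ℝ (Fin N)))
    (hl : ∀ a ∈ l, a.2.1 ∈ P.stitch a.1 ∧ a.2.2 ∈ P.stitch a.1) {r s : ℝ} (hr : 0 < r) (hs : 0 < s)
    (h : P.pathLength v l w < r + s) :
    ∃ u, dist (P.proj v) u < r ∧ dist u (P.proj w) < s := by
  induction l generalizing v r with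
  | nil =>
    obtain ⟨u, hu1, hu2⟩ := exists_dist_lt_lt hr hs (show dist v w < s + r by rw [add_comm]; exact h)
    exact ⟨P.proj u, (P.dist_proj_le _ _).trans_lt hu1, (P.dist_proj_le _ _).trans_lt hu2⟩
  | cons a l ih =>
    have ha := hl a List.mem_cons_self
    have hl' : ∀ b ∈ l, _ := fun b hb => hl b (List.mem_cons_of_mem _ hb)
    have heq : P.proj a.2.1 = P.proj a.2.2 := by rw [P.proj_of_mem ha.1, P.proj_of_mem ha.2]
    simp only [pathLength] at h
    have h1 := P.dist_proj_le v a.2.1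
    by_cases hva : dist v a.2.1 < r
    · obtain ⟨u, hu1, hu2⟩ := ih a.2.2 hl' (sub_pos.2 hva) (by linarith)
      rw [← heq] at hu1
      exact ⟨u, by linarith [dist_triangle (P.proj v) (P.proj a.2.1) u], hu2⟩
    -- The cut falls on the first segment; what is left of `s` after the rest of the chain bounds
    -- the remainder of that segment.
    · push Not at hva
      obtain ⟨u, hu1, hu2⟩ := exists_dist_lt_lt (x := v) (z := a.2.1)
        (ε := s - P.pathLength a.2.2 l w) hr (by linarith) (by linarith)
      have h2 := P.dist_proj_le_pathLength a.2.2 w l hl'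
      have h3 := P.dist_proj_le u a.2.1
      have h4 := dist_triangle (P.proj u) (P.proj a.2.1) (P.proj w)
      rw [← heq] at h2
      exact ⟨P.proj u, (P.dist_proj_le _ _).trans_lt hu1, by linarith⟩

theorem dist_le_mul_dist_proj_add {L δ : ℝ≥0} (hδ : 0 < δ) (hL : P.lengthMax ≤ (L : ℝ≥0∞))
    (hsep : (δ : ℝ≥0∞) ≤ P.separation) (v w : EuclideanSpace ℝ (Fin N)) :
    dist v w ≤ (1 + L / δ) * dist (P.proj v) (P.proj w) + 3 * L := by
  have hδ : (0 : ℝ) < δ := hδ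
  have hC : (0 : ℝ) < 1 + L / δ := by positivity
  -- Solved for the smocked distance, the claim is a lower bound for an infimum and can be checked
  -- chain by chain.
  suffices h : (dist v w - 3 * L) / (1 + L / δ) ≤ dist (P.proj v) (P.proj w) by
    rw [div_le_iff₀ hC] at h
    linarith
  refine le_csInf (P.connectingLengths_nonempty _ _) ?_
  rintro ℓ ⟨v', w', hv, hw, -, l, -, hl, hc, rfl⟩
  have h1 := P.dist_le_of_proj_eq hL hv
  have h2 := P.dist_le_of_proj_eq hL hw
  have h3 := P.dist_le_pathLength_add hL v' w' l hl
  have h4 := P.length_mul_le_pathLength_add hsep v' w' l hl hc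
  have h5 := dist_triangle4 v v' w' w
  -- This contributes one of the three `L`; the other two come from moving `v` and `w` within their
  -- fibres to the ends of the chain.
  have h6 : l.length * (L : ℝ) ≤ L / δ * P.pathLength v' l w' + L := by
    calc l.length * (L : ℝ) = L / δ * (l.length * δ) := by field_simp
      _ ≤ L / δ * (P.pathLength v' l w' + δ) := by gcongr
      _ = _ := by field_simp
  rw [div_le_iff₀ hC]
  rw [dist_comm] at h1
  linarith

theorem isCoarseQuotientMap_proj {L δ : ℝ≥0} (hδ : 0 < δ) (hL : P.lengthMax ≤ (L : ℝ≥0∞))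
    (hsep : (δ : ℝ≥0∞) ≤ P.separation) :
    IsCoarseQuotientMap (1 + L / δ : ℝ) (3 * L) P.proj where
  surjective := P.proj_surjective
  dist_map_le := P.dist_proj_le
  dist_le := P.dist_le_mul_dist_proj_add hδ hL hsep
  exists_between p q r s hr hs hpq := by
    obtain ⟨_, ⟨v, w, rfl, rfl, -, l, -, hl, -, rfl⟩, hlt⟩ :=
      exists_lt_of_csInf_lt (P.connectingLengths_nonempty p q) hpq
    exact P.exists_between_of_pathLength_lt v w l hl hr hs hlt

/-- A smocking with finite depth and stitches of positive length lives in positive dimension. -/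
theorem nontrivial_of_depth_ne_top (hdepth : P.depth ≠ ∞) (hlen : 0 < P.lengthMin) :
    Nontrivial (EuclideanSpace ℝ (Fin N)) := by
  by_contra hN
  rw [not_nontrivial_iff_subsingleton] at hN
  obtain ⟨r, hr, -⟩ := sInf_lt_iff.1 (lt_top_iff_ne_top.2 hdepth)
  -- Finite depth yields at least one stitch, which in a one-point space would have diameter zero.
  obtain ⟨j, -⟩ := hr 0
  have h : P.lengthMin ≤ Metric.ediam (P.stitch j) := iInf_le _ j
  rw [Metric.ediam_subsingleton subsingleton_of_subsingleton] at h
  exact absurd hlen h.not_gt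

end Smocking

theorem proposition3p5 (N : ℕ) (P : ℕ → Smocking N) (Lmax h δ Lmin : ℝ≥0)
    (hδ : 0 < δ) (hLmin : 0 < Lmin)
    (hLmax_le : ∀ k, (P k).lengthMax ≤ (Lmax : ℝ≥0∞))
    (hdepth_le : ∀ k, (P k).depth ≤ (h : ℝ≥0∞))
    (hδ_le : ∀ k, (δ : ℝ≥0∞) ≤ (P k).separation)
    (hLmin_le : ∀ k, (Lmin : ℝ≥0∞) ≤ (P k).lengthMin) :
    PGHPrecompact (fun k => (P k).proj 0) := by
  have := (P 0).nontrivial_of_depth_ne_top (ne_top_of_le_ne_top ENNReal.coe_ne_top (hdepth_le 0))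
    ((ENNReal.coe_pos.2 hLmin).trans_le (hLmin_le 0))
  have : NoncompactSpace (EuclideanSpace ℝ (Fin N)) := NormedSpace.noncompactSpace ℝ _
  exact IsCoarseQuotientMap.pghPrecompact
    (fun k => (P k).isCoarseQuotientMap_proj hδ (hLmax_le k) (hδ_le k)) (by positivity) 0
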